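/- Let $\mathcal H_A,\mathcal H_B$ be finite-dimensional complex Hilbert spaces, let $\rho_{AB}$ be a density operator on $\mathcal H_A\otimes\mathcal H_B$, and let $\varepsilon\ge 0$. Let $\mathcal F(\rho,\sigma)=\big(\operatorname{Tr}\sqrt{\sqrt{\sigma}\,\rho\sqrt{\sigma}}\big)^2$, let $B^\varepsilon(\rho_{AB})$ be the set of density operators $\tilde\rho_{AB}$ with $\sqrt{1-\mathcal F(\rho_{AB},\tilde\rho_{AB})}\le\varepsilon$, and put $\rho_A=\operatorname{Tr}_B\rho_{AB}$, $\tilde\rho_B=\operatorname{Tr}_A\tilde\rho_{AB}$. Let $D_{\max}(\rho\|\sigma)=\log_2\|\sigma^{-1/2}\rho\,\sigma^{-1/2}\|_\infty$ if $\operatorname{supp}\rho\subseteq\operatorname{supp}\sigma$ and $+\infty$ otherwise, let $$I^\varepsilon_{\max}(\rho_{AB})=\inf_{\tilde\rho_{AB}\in B^\varepsilon(\rho_{AB})}D_{\max}(\tilde\rho_{AB}\,\|\,\rho_A\otimes\tilde\rho_B),$$ and let $$\lambda_{\min}=\inf\{\lambda\ge 0:\ \lambda\,\rho_A\otimes\tilde\rho_B-\tilde\rho_{AB}\ge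 0\ \text{for some}\ \tilde\rho_{AB}\in B^\varepsilon(\rho_{AB})\}.$$ Consider the following algorithm. Start with $\rho^1_{AB}=\rho_{AB}$. In iteration $i$, compute $$\lambda^i=\inf\{\lambda\ge0:\ \lambda\,\rho_A\otimes\rho^i_B-\rho^i_{AB}\ge0\},$$ $$\mu^i=\sup\{\mu\ge0:\ \lambda^i\rho_A\otimes\tilde\rho_B-\tilde\rho_{AB}-\mu\mathbb 1\ge0\ \text{for some}\ \tilde\rho_{AB}\in B^\varepsilon(\rho_{AB})\}.$$ If $\mu^i=0$, stop. Otherwise let $\rho^{i+1}_{AB}$ be any $\tilde\rho_{AB}\in B^\varepsilon(\rho_{AB})$ at which the supremum $\mu^i$ is attained, and go to iteration $i+1$. Assume that $\rho_A\otimes\tilde\rho_B$ is positive definite for every $\tilde\rho_{AB}\in B^\varepsilon(\rho_{AB})$. Then $\lambda_{\min}>0$ and $I^\varepsilon_{\max}(\rho_{AB})=\log_2\lambda_{\min}$. The algorithm is well defined: the infimum $\lambda^i$ and the supremum $\mu^i$ are attained in every iteration that is carried out. For every choice of the maximizers, the procedure converges to $\lambda_{\min}$: in every iteration carried out, the stopping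 criterion $\mu^i=0$ holds if and only if $\lambda^i=\lambda_{\min}$; and either the algorithm stops after finitely many iterations, with $\lambda^i=\lambda_{\min}$, or it runs forever and $\lambda^i\to\lambda_{\min}$ as $i\to\infty$. -/

import Mathlib

open scoped Kronecker ComplexOrder

noncomputable section

namespace SmoothMaxMutual

section SingleSystem

variable {n : Type*} [Fintype n] [DecidableEq n]

/-- Density operators on `ℂⁿ`: positive semidefinite with unit trace. -/
def IsState (ρ : Matrix n n ℂ) : Prop :=
  ρ.PosSemidef ∧ ρ.trace = 1

/-- Square root of a Hermitian positive semidefinite matrix (functional calculus). -/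
def matSqrt (M : Matrix n n ℂ) : Matrix n n ℂ :=
  cfc Real.sqrt M

/-- `M ^ (-1/2)`, inverted on the support of the positive semidefinite matrix `M`
(the eigenvalue `0` is sent to `0`). -/
def matInvSqrt (M : Matrix n n ℂ) : Matrix n n ℂ :=
  cfc (fun x : ℝ => (Real.sqrt x)⁻¹) M

/-- The fidelity `(Tr √(√σ ρ √σ))²`. -/
def fidelity (ρ σ : Matrix n n ℂ) : ℝ :=
  ((matSqrt (matSqrt σ * ρ * matSqrt σ)).trace.re) ^ 2

/-- The sine distance `√(1 - F(ρ, σ))`. -/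
def sineDist (ρ σ : Matrix n n ℂ) : ℝ :=
  Real.sqrt (1 - fidelity ρ σ)

/-- The smoothing environment of `ρ`: all states at sine distance at most `ε`. -/
def smoothBall (ε : ℝ) (ρ : Matrix n n ℂ) : Set (Matrix n n ℂ) :=
  {τ | IsState τ ∧ sineDist ρ τ ≤ ε}

/-- The spectral norm (operator norm for the Euclidean norm on `ℂⁿ`). -/
def spectralNorm (M : Matrix n n ℂ) : ℝ :=
  ‖Matrix.toEuclideanCLM (𝕜 := ℂ) M‖

open Classical in
/-- The max-relative entropy: `log₂ ‖σ^(-1/2) ρ σ^(-1/2)‖` if the support (range) of `ρ` is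
contained in that of `σ`, and `+∞` otherwise. -/
def Dmax (ρ σ : Matrix n n ℂ) : EReal :=
  if LinearMap.range ρ.mulVecLin ≤ LinearMap.range σ.mulVecLin then
    ((Real.logb 2 (spectralNorm (matInvSqrt σ * ρ * matInvSqrt σ)) : ℝ) : EReal)
  else ⊤

end SingleSystem

section Bipartite

variable {A B : Type*} [Fintype A] [DecidableEq A] [Fintype B] [DecidableEq B]

/-- The marginal on `A`, i.e. the partial trace over `B`. -/
def margA (ρ : Matrix (A × B) (A × B) ℂ) : Matrix A A ℂ :=
  Matrix.of fun a a' => ∑ b, ρ (a, b) (a', b)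

/-- The marginal on `B`, i.e. the partial trace over `A`. -/
def margB (ρ : Matrix (A × B) (A × B) ℂ) : Matrix B B ℂ :=
  Matrix.of fun b b' => ∑ a, ρ (a, b) (a, b')

/-- The smooth max-mutual information, an infimum in the extended reals. -/
def Imax (ε : ℝ) (ρ : Matrix (A × B) (A × B) ℂ) : EReal :=
  ⨅ τ ∈ smoothBall ε ρ, Dmax τ (margA ρ ⊗ₖ margB τ)

/-- Admissible `l ≥ 0` for a fixed state `τ`: `l ρ_A ⊗ τ_B - τ ≥ 0`. -/
def lambdaSet (ρ τ : Matrix (A × B) (A × B) ℂ) : Set ℝ :=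
  {l | 0 ≤ l ∧ (l • (margA ρ ⊗ₖ margB τ) - τ).PosSemidef}

/-- The joint infimum over the states `τ` in the ball and the `l ≥ 0` admissible for `τ`. -/
def lambdaMin (ε : ℝ) (ρ : Matrix (A × B) (A × B) ℂ) : ℝ :=
  sInf {l | ∃ τ ∈ smoothBall ε ρ, l ∈ lambdaSet ρ τ}

/-- The number computed from the current state `τ` in the first half of an iteration. -/
def lambdaOf (ρ τ : Matrix (A × B) (A × B) ℂ) : ℝ :=
  sInf (lambdaSet ρ τ)

/-- `(m, τ)` is feasible for the second semidefinite program with parameter `l`. -/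
def MuFeasible (ε : ℝ) (ρ : Matrix (A × B) (A × B) ℂ) (l m : ℝ)
    (τ : Matrix (A × B) (A × B) ℂ) : Prop :=
  0 ≤ m ∧ τ ∈ smoothBall ε ρ ∧
    (l • (margA ρ ⊗ₖ margB τ) - τ - m • (1 : Matrix (A × B) (A × B) ℂ)).PosSemidef

/-- The objective values attained by feasible points of the second program. -/
def muSet (ε : ℝ) (ρ : Matrix (A × B) (A × B) ℂ) (l : ℝ) : Set ℝ :=
  {m | ∃ τ, MuFeasible ε ρ l m τ}

/-- The optimal value of the second program with parameter `l`. -/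
def muOf (ε : ℝ) (ρ : Matrix (A × B) (A × B) ℂ) (l : ℝ) : ℝ :=
  sSup (muSet ε ρ l)

/-- `λ` of iteration `i` (counted from `0`) when the states used are `s 0, s 1, …`. -/
def lam (ρ : Matrix (A × B) (A × B) ℂ) (s : ℕ → Matrix (A × B) (A × B) ℂ) (i : ℕ) : ℝ :=
  lambdaOf ρ (s i)

/-- `μ` of iteration `i`. -/
def mu (ε : ℝ) (ρ : Matrix (A × B) (A × B) ℂ) (s : ℕ → Matrix (A × B) (A × B) ℂ) (i : ℕ) : ℝ :=
  muOf ε ρ (lam ρ s i)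

/-- Iteration `i` is carried out: no earlier iteration has met the stopping criterion `μ = 0`. -/
def Reached (ε : ℝ) (ρ : Matrix (A × B) (A × B) ℂ) (s : ℕ → Matrix (A × B) (A × B) ℂ)
    (i : ℕ) : Prop :=
  ∀ j < i, mu ε ρ s j ≠ 0

/-- `s` records a run of the algorithm: it starts at `ρ`, and as long as the algorithm has not
stopped, the next state is some maximizer of the second program, with no restriction on which.
The entries of `s` after the stop are irrelevant. -/
def IsRun (ε : ℝ) (ρ : Matrix (A × B) (A × B) ℂ) (s : ℕ → Matrix (A × B) (A × B) ℂ) : Prop :=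
  s 0 = ρ ∧
    ∀ i, Reached ε ρ s (i + 1) → MuFeasible ε ρ (lam ρ s i) (mu ε ρ s i) (s (i + 1))

end Bipartite

end SmoothMaxMutual

end

/-!
The argument compares the two programs of an iteration. Traces show that every admissible `l` is at
least `1`, and that `σ = ρ_A ⊗ τ_B` satisfies `σ ≤ 1`, while by assumption `σ ≥ δ` for some
`δ > 0` depending on `τ`. Hence a margin `m` in `l σ - τ ≥ m` lets `l` be lowered to `l - m`
(`MuFeasible.sub_mem_lambdaSet`), and an admissible `l' ≤ l` for `τ` leaves the margin
`(l - l') δ` (`muFeasible_of_mem_lambdaSet`). So `μ = 0` exactly at the target value. Along a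
run that never stops, `λ` decreases by at least `μ` in each step; being bounded below, it
converges and `μ → 0`, while a limit strictly above the target value would keep `μ` above a
positive constant, coming from one fixed near-optimal `τ` (`IsRun.tendsto_lam`).

No convexity of the smoothing ball is used. The maximum over `m` exists because the ball is compact,
the fidelity being continuous through the continuity of the functional calculus
(`isCompact_smoothBall`). The minimum over `l` is the norm of `σ^(-1/2) τ σ^(-1/2)`, which also
identifies the smooth max-mutual information with the logarithm of the target value.
-/

noncomputable section

namespace SmoothMaxMutual

/-! ### Matrix analysis: square roots and operator inequalities -/

section SingleSystem

open scoped MatrixOrder Matrix.Norms.L2Operator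

variable {n : Type*} [Fintype n] [DecidableEq n]

lemma isHermitian_matSqrt (M : Matrix n n ℂ) : (matSqrt M).IsHermitian :=
  cfc_predicate (p := IsSelfAdjoint) Real.sqrt M

lemma continuousOn_matSqrt : ContinuousOn matSqrt {M : Matrix n n ℂ | M.IsHermitian} :=
  ContinuousOn.cfc_of_mem_nhdsSet (A := Matrix n n ℂ) (p := IsSelfAdjoint) (s := Set.univ)
    Real.sqrt Filter.univ_mem continuousOn_id (fun _ h => h) Real.continuous_sqrt.continuousOn

lemma continuousOn_fidelity {ρ : Matrix n n ℂ} (hρ : ρ.IsHermitian) :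
    ContinuousOn (fidelity ρ) {σ : Matrix n n ℂ | σ.IsHermitian} := by
  have hs := continuousOn_matSqrt (n := n)
  have hin : ContinuousOn (fun σ : Matrix n n ℂ => matSqrt σ * ρ * matSqrt σ)
      {σ | σ.IsHermitian} := (hs.mul continuousOn_const).mul hs
  have hout := hs.comp hin fun σ _ => by
    have h := Matrix.isHermitian_mul_mul_conjTranspose (matSqrt σ) hρ
    rwa [(isHermitian_matSqrt σ).eq] at h
  have htr : Continuous fun M : Matrix n n ℂ => M.trace.re :=
    Complex.continuous_re.comp continuous_id.matrix_trace
  exact (htr.comp_continuousOn hout).pow 2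

/-- A state has fidelity `1` with itself: `√ρ ρ √ρ = ρ²`, whose square root is `ρ`. -/
lemma fidelity_self {ρ : Matrix n n ℂ} (hρ : IsState ρ) : fidelity ρ ρ = 1 := by
  have hsa : IsSelfAdjoint ρ := hρ.1.isHermitian
  have hspec : ∀ x ∈ spectrum ℝ ρ, 0 ≤ x := fun x hx =>
    spectrum_nonneg_of_nonneg (Matrix.nonneg_iff_posSemidef.2 hρ.1) hx
  have hsq : matSqrt ρ * matSqrt ρ = ρ := by
    rw [matSqrt, ← cfc_mul Real.sqrt Real.sqrt ρ]
    conv_rhs => rw [← cfc_id ℝ ρ]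
    exact cfc_congr fun x hx => Real.mul_self_sqrt (hspec x hx)
  have hin : matSqrt ρ * ρ * matSqrt ρ = ρ ^ 2 := by
    calc matSqrt ρ * ρ * matSqrt ρ
        = matSqrt ρ * (matSqrt ρ * matSqrt ρ) * matSqrt ρ := by rw [hsq]
      _ = (matSqrt ρ * matSqrt ρ) * (matSqrt ρ * matSqrt ρ) := by noncomm_ring
      _ = ρ ^ 2 := by rw [hsq, sq]
  have hout : matSqrt (ρ ^ 2) = ρ := by
    rw [matSqrt, ← cfc_comp_pow Real.sqrt 2 ρ]
    conv_rhs => rw [← cfc_id ℝ ρ]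
    exact cfc_congr fun x hx => Real.sqrt_sq (hspec x hx)
  rw [fidelity, hin, hout, hρ.2]
  simp

lemma mem_smoothBall_self {ε : ℝ} (hε : 0 ≤ ε) {ρ : Matrix n n ℂ} (hρ : IsState ρ) :
    ρ ∈ smoothBall ε ρ :=
  ⟨hρ, by simpa [sineDist, fidelity_self hρ] using hε⟩

lemma isClosed_posSemidef : IsClosed {M : Matrix n n ℂ | M.PosSemidef} := by
  simpa only [Matrix.nonneg_iff_posSemidef] using
    CStarAlgebra.isClosed_nonneg (A := Matrix n n ℂ)

lemma le_one_of_isState {τ : Matrix n n ℂ} (hτ : IsState τ) : τ ≤ 1 := by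
  have hH := hτ.1.isHermitian
  have hsum : ∑ i, hH.eigenvalues i = 1 := by
    have h := hH.trace_eq_sum_eigenvalues
    rw [hτ.2, ← RCLike.ofReal_sum] at h
    exact (Complex.ofReal_eq_one.1 h.symm)
  have h : τ ≤ algebraMap ℝ (Matrix n n ℂ) 1 := by
    refine le_algebraMap_of_spectrum_le (fun x hx => ?_) hH
    rw [hH.spectrum_real_eq_range_eigenvalues] at hx
    obtain ⟨i, rfl⟩ := hx
    rw [← hsum]
    exact Finset.single_le_sum (fun j _ => hτ.1.eigenvalues_nonneg j) (Finset.mem_univ i)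
  simpa using h

lemma isCompact_setOf_isState : IsCompact {τ : Matrix n n ℂ | IsState τ} := by
  have : ProperSpace (Matrix n n ℂ) := FiniteDimensional.proper ℂ _
  refine (isCompact_closedBall (0 : Matrix n n ℂ) 1).of_isClosed_subset ?_ fun τ hτ => ?_
  · exact isClosed_posSemidef.inter
      (isClosed_eq continuous_id.matrix_trace continuous_const)
  · rw [mem_closedBall_zero_iff]
    refine (CStarAlgebra.norm_le_iff_le_algebraMap τ zero_le_one
      (Matrix.nonneg_iff_posSemidef.2 hτ.1)).2 ?_
    simpa using le_one_of_isState hτ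

lemma isCompact_smoothBall (ε : ℝ) {ρ : Matrix n n ℂ} (hρ : IsState ρ) :
    IsCompact (smoothBall ε ρ) := by
  have hcont : ContinuousOn (sineDist ρ) {τ : Matrix n n ℂ | IsState τ} :=
    (continuousOn_const.sub ((continuousOn_fidelity hρ.1.isHermitian).mono
      fun _ h => h.1.isHermitian)).sqrt
  exact isCompact_setOf_isState.of_isClosed_subset
    (hcont.preimage_isClosed_of_isClosed isCompact_setOf_isState.isClosed isClosed_Iic)
    fun _ h => h.1

/-- A positive definite matrix is bounded below by its least eigenvalue. -/
lemma exists_pos_smul_one_le {σ : Matrix n n ℂ} (hσ : σ.PosDef) :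
    ∃ δ : ℝ, 0 < δ ∧ δ • (1 : Matrix n n ℂ) ≤ σ := by
  cases isEmpty_or_nonempty n
  · exact ⟨1, one_pos, (Subsingleton.elim _ _).le⟩
  obtain ⟨δ, hδ, h⟩ := (CFC.exists_pos_algebraMap_le_iff (A := Matrix n n ℂ)
    hσ.isHermitian).2 fun x hx =>
      (Matrix.isStrictlyPositive_iff_posDef.2 hσ).spectrum_pos hx
  exact ⟨δ, hδ, by rwa [← Algebra.algebraMap_eq_smul_one]⟩

lemma matInvSqrt_mul_mul_matInvSqrt {σ : Matrix n n ℂ} (hσ : σ.PosDef) :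
    matInvSqrt σ * σ * matInvSqrt σ = 1 := by
  have hsa : IsSelfAdjoint σ := hσ.isHermitian
  have hspec : ∀ x ∈ spectrum ℝ σ, 0 < x := fun x hx =>
    (Matrix.isStrictlyPositive_iff_posDef.2 hσ).spectrum_pos hx
  have hc : ContinuousOn (fun x : ℝ => (Real.sqrt x)⁻¹) (spectrum ℝ σ) :=
    Real.continuous_sqrt.continuousOn.inv₀ fun x hx => (Real.sqrt_pos.2 (hspec x hx)).ne'
  have h1 : matInvSqrt σ * σ = cfc (fun x : ℝ => (Real.sqrt x)⁻¹ * x) σ := by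
    conv_lhs => rw [matInvSqrt]; rhs; rw [← cfc_id ℝ σ]
    exact (cfc_mul _ _ σ hc continuousOn_id).symm
  rw [h1, matInvSqrt, ← cfc_mul (fun x : ℝ => (Real.sqrt x)⁻¹ * x) _ σ
    (hc.mul continuousOn_id) hc, ← cfc_const_one ℝ σ]
  refine cfc_congr fun x hx => ?_
  have hx' := Real.sqrt_pos.2 (hspec x hx)
  have := Real.mul_self_sqrt (hspec x hx).le
  field_simp
  rw [sq, this]

/-- For invertible `σ`, `σ^(-1/2) τ σ^(-1/2)` has norm at most `l` exactly when `τ ≤ l σ`: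
conjugation by the invertible matrix `σ^(-1/2)` preserves and reflects positivity. -/
lemma spectralNorm_conj_matInvSqrt_le_iff {τ σ : Matrix n n ℂ} (hτ : τ.PosSemidef)
    (hσ : σ.PosDef) {l : ℝ} (hl : 0 ≤ l) :
    spectralNorm (matInvSqrt σ * τ * matInvSqrt σ) ≤ l ↔ (l • σ - τ).PosSemidef := by
  set S := matInvSqrt σ with hS
  have hSH : star S = S := (cfc_predicate (p := IsSelfAdjoint) _ σ : IsSelfAdjoint S)
  have hSσ : S * σ * S = 1 := matInvSqrt_mul_mul_matInvSqrt hσ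
  have hSu : IsUnit S := IsUnit.of_mul_eq_one (σ * S) (by rw [← mul_assoc, hSσ])
  have hpos : (S * τ * S).PosSemidef := by
    have h := hτ.mul_mul_conjTranspose_same S
    rwa [← Matrix.star_eq_conjTranspose, hSH] at h
  have hconj : S * (l • σ - τ) * S = algebraMap ℝ (Matrix n n ℂ) l - S * τ * S := by
    rw [mul_sub, sub_mul, mul_smul_comm, smul_mul_assoc, hSσ, Algebra.algebraMap_eq_smul_one]
  have hiff := Matrix.IsUnit.posSemidef_star_right_conjugate_iff (x := l • σ - τ) hSu
  rw [hSH, hconj] at hiff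
  rw [← hiff]
  exact CStarAlgebra.norm_le_iff_le_algebraMap (S * τ * S) hl
    (Matrix.nonneg_iff_posSemidef.2 hpos)

lemma Dmax_of_posDef (τ : Matrix n n ℂ) {σ : Matrix n n ℂ} (hσ : σ.PosDef) :
    Dmax τ σ =
      ((Real.logb 2 (spectralNorm (matInvSqrt σ * τ * matInvSqrt σ)) : ℝ) : EReal) := by
  refine if_pos ?_
  have : LinearMap.range σ.mulVecLin = ⊤ :=
    LinearMap.range_eq_top.2 (Matrix.mulVec_surjective_iff_isUnit.2 hσ.isUnit)
  rw [this]
  exact le_top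

end SingleSystem

/-! ### The two optimization programs -/

section Bipartite

variable {A B : Type*} [Fintype A] [Fintype B] {ε l m : ℝ} {ρ τ : Matrix (A × B) (A × B) ℂ}

lemma trace_margA_kronecker_margB (hρ : IsState ρ) (hτ : IsState τ) :
    (margA ρ ⊗ₖ margB τ).trace = 1 := by
  have hA : (margA ρ).trace = ρ.trace := by
    simp [margA, Matrix.trace, Fintype.sum_prod_type]
  have hB : (margB τ).trace = τ.trace := by
    simp [margB, Matrix.trace, Fintype.sum_prod_type_right]
  rw [Matrix.trace_kronecker, hA, hB, hρ.2, hτ.2, one_mul]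

lemma continuous_margA_kronecker_margB :
    Continuous fun τ : Matrix (A × B) (A × B) ℂ => margA ρ ⊗ₖ margB τ := by
  refine continuous_matrix fun i j => ?_
  simp only [Matrix.kroneckerMap_apply, margA, margB, Matrix.of_apply]
  fun_prop

lemma bddBelow_lambdaSet : BddBelow (lambdaSet ρ τ) :=
  ⟨0, fun _ h => h.1⟩

/-- Taking traces in `τ ≤ l ρ_A ⊗ τ_B` gives `1 ≤ l`. -/
lemma one_le_of_posSemidef (hρ : IsState ρ) (hτ : IsState τ)
    (h : (l • (margA ρ ⊗ₖ margB τ) - τ).PosSemidef) : 1 ≤ l := by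
  have h0 := h.trace_nonneg
  rw [Matrix.trace_sub, Matrix.trace_smul, trace_margA_kronecker_margB hρ hτ, hτ.2] at h0
  have h1 := (Complex.le_def.1 h0).1
  simpa using h1

lemma one_le_of_mem_lambdaSet (hρ : IsState ρ) (hτ : IsState τ) (h : l ∈ lambdaSet ρ τ) :
    1 ≤ l :=
  one_le_of_posSemidef hρ hτ h.2

variable [DecidableEq A] [DecidableEq B]

lemma bddBelow_joint :
    BddBelow {l | ∃ τ ∈ smoothBall ε ρ, l ∈ lambdaSet ρ τ} :=
  ⟨0, fun _ ⟨_, _, h⟩ => h.1⟩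

/-- The first program attains its value, the spectral norm of `σ^(-1/2) τ σ^(-1/2)` for
`σ = ρ_A ⊗ τ_B`. -/
lemma isLeast_lambdaSet (hτ : IsState τ) (hσ : (margA ρ ⊗ₖ margB τ).PosDef) :
    IsLeast (lambdaSet ρ τ) (spectralNorm (matInvSqrt (margA ρ ⊗ₖ margB τ) * τ *
      matInvSqrt (margA ρ ⊗ₖ margB τ))) := by
  have h0 : 0 ≤ spectralNorm (matInvSqrt (margA ρ ⊗ₖ margB τ) * τ *
      matInvSqrt (margA ρ ⊗ₖ margB τ)) := norm_nonneg _
  exact ⟨⟨h0, (spectralNorm_conj_matInvSqrt_le_iff hτ.1 hσ h0).1 le_rfl⟩,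
    fun l hl => (spectralNorm_conj_matInvSqrt_le_iff hτ.1 hσ hl.1).2 hl.2⟩

lemma lambdaOf_mem_lambdaSet (hτ : IsState τ) (hσ : (margA ρ ⊗ₖ margB τ).PosDef) :
    lambdaOf ρ τ ∈ lambdaSet ρ τ := by
  have h := isLeast_lambdaSet hτ hσ
  rw [lambdaOf, h.csInf_eq]
  exact h.1

lemma Dmax_eq_logb_lambdaOf (hτ : IsState τ) (hσ : (margA ρ ⊗ₖ margB τ).PosDef) :
    Dmax τ (margA ρ ⊗ₖ margB τ) = ((Real.logb 2 (lambdaOf ρ τ) : ℝ) : EReal) := by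
  rw [Dmax_of_posDef τ hσ, lambdaOf, (isLeast_lambdaSet hτ hσ).csInf_eq]

open scoped MatrixOrder in
/-- Since `ρ_A ⊗ τ_B ≤ 1`, a feasible margin `m` can be traded for lowering `l` by `m`. -/
lemma MuFeasible.sub_mem_lambdaSet (hρ : IsState ρ) (hσ : (margA ρ ⊗ₖ margB τ).PosSemidef)
    (h : MuFeasible ε ρ l m τ) : l - m ∈ lambdaSet ρ τ := by
  obtain ⟨hm, hτ, hpsd⟩ := h
  have hle : margA ρ ⊗ₖ margB τ ≤ 1 :=
    le_one_of_isState ⟨hσ, trace_margA_kronecker_margB hρ hτ.1⟩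
  have hps : ((l - m) • (margA ρ ⊗ₖ margB τ) - τ).PosSemidef := by
    have h := hpsd.add (Matrix.PosSemidef.smul (Matrix.le_iff.1 hle) hm)
    convert h using 1
    module
  exact ⟨zero_le_one.trans (one_le_of_posSemidef hρ hτ.1 hps), hps⟩

open scoped MatrixOrder in
/-- Conversely, if `l'` is admissible for `τ` and `ρ_A ⊗ τ_B ≥ δ`, then `l ≥ l'` leaves the
margin `(l - l') δ`. -/
lemma muFeasible_of_mem_lambdaSet {l' δ : ℝ} (hτ : τ ∈ smoothBall ε ρ)
    (hl' : l' ∈ lambdaSet ρ τ) (hll : l' ≤ l) (hδ : 0 ≤ δ)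
    (hσ : δ • (1 : Matrix (A × B) (A × B) ℂ) ≤ margA ρ ⊗ₖ margB τ) :
    MuFeasible ε ρ l ((l - l') * δ) τ := by
  refine ⟨mul_nonneg (sub_nonneg.2 hll) hδ, hτ, ?_⟩
  have h := hl'.2.add (Matrix.PosSemidef.smul (Matrix.le_iff.1 hσ) (sub_nonneg.2 hll))
  convert h using 1
  module

/-- The second program attains its value: its feasible set is compact, the margin being at most
`l - 1`. -/
lemma isGreatest_muSet (hρ : IsState ρ)
    (hfull : ∀ τ ∈ smoothBall ε ρ, (margA ρ ⊗ₖ margB τ).PosDef)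
    (hτ : τ ∈ smoothBall ε ρ) (hl : l ∈ lambdaSet ρ τ) :
    IsGreatest (muSet ε ρ l) (muOf ε ρ l) := by
  have heq : muSet ε ρ l = Prod.snd '' ((smoothBall ε ρ ×ˢ Set.Icc 0 (l - 1)) ∩
      {p | (l • (margA ρ ⊗ₖ margB p.1) - p.1 -
        p.2 • (1 : Matrix (A × B) (A × B) ℂ)).PosSemidef}) := by
    ext m
    constructor
    · rintro ⟨τ, h⟩
      have := one_le_of_mem_lambdaSet hρ h.2.1.1
        (h.sub_mem_lambdaSet hρ (hfull τ h.2.1).posSemidef)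
      exact ⟨(τ, m), ⟨⟨h.2.1, h.1, by linarith⟩, h.2.2⟩, rfl⟩
    · rintro ⟨⟨τ, m⟩, ⟨⟨h1, h2⟩, h3⟩, rfl⟩
      exact ⟨τ, h2.1, h1, h3⟩
  have hcl : IsClosed {p : Matrix (A × B) (A × B) ℂ × ℝ | (l • (margA ρ ⊗ₖ margB p.1) - p.1 -
      p.2 • (1 : Matrix (A × B) (A × B) ℂ)).PosSemidef} := by
    refine isClosed_posSemidef.preimage (Continuous.sub (Continuous.sub ?_ continuous_fst) ?_)
    · exact (continuous_margA_kronecker_margB.comp continuous_fst).const_smul l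
    · exact continuous_snd.smul continuous_const
  have hcomp : IsCompact (muSet ε ρ l) := by
    rw [heq]
    exact (((isCompact_smoothBall ε hρ).prod isCompact_Icc).inter_right hcl).image continuous_snd
  have h0 : MuFeasible ε ρ l 0 τ := ⟨le_rfl, hτ, by simpa using hl.2⟩
  exact hcomp.isGreatest_sSup ⟨0, τ, h0⟩

/-! ### The target value -/

lemma exists_mem_lambdaSet_lt (hρball : ρ ∈ smoothBall ε ρ)
    (hσ : (margA ρ ⊗ₖ margB ρ).PosDef) {x : ℝ} (hx : lambdaMin ε ρ < x) :
    ∃ τ ∈ smoothBall ε ρ, ∃ l ∈ lambdaSet ρ τ, l < x := by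
  have hne : {l | ∃ τ ∈ smoothBall ε ρ, l ∈ lambdaSet ρ τ}.Nonempty :=
    ⟨_, ρ, hρball, lambdaOf_mem_lambdaSet hρball.1 hσ⟩
  obtain ⟨l, ⟨τ, hτ, hl⟩, hlx⟩ := exists_lt_of_csInf_lt hne hx
  exact ⟨τ, hτ, l, hl, hlx⟩

lemma lambdaMin_le (hτ : τ ∈ smoothBall ε ρ) (hl : l ∈ lambdaSet ρ τ) : lambdaMin ε ρ ≤ l :=
  csInf_le bddBelow_joint ⟨τ, hτ, hl⟩

lemma one_le_lambdaMin (hρ : IsState ρ) (hρball : ρ ∈ smoothBall ε ρ)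
    (hσ : (margA ρ ⊗ₖ margB ρ).PosDef) : 1 ≤ lambdaMin ε ρ :=
  le_csInf ⟨_, ρ, hρball, lambdaOf_mem_lambdaSet hρ hσ⟩
    fun _ ⟨_, hτ, hl⟩ => one_le_of_mem_lambdaSet hρ hτ.1 hl

lemma Imax_eq_logb_lambdaMin (hρ : IsState ρ) (hρball : ρ ∈ smoothBall ε ρ)
    (hfull : ∀ τ ∈ smoothBall ε ρ, (margA ρ ⊗ₖ margB τ).PosDef) :
    Imax ε ρ = ((Real.logb 2 (lambdaMin ε ρ) : ℝ) : EReal) := by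
  have hpos : 0 < lambdaMin ε ρ :=
    zero_lt_one.trans_le (one_le_lambdaMin hρ hρball (hfull ρ hρball))
  apply le_antisymm
  · refine EReal.le_of_forall_lt_iff_le.1 fun x hx => ?_
    have hx' : lambdaMin ε ρ < 2 ^ x :=
      (Real.logb_lt_iff_lt_rpow one_lt_two hpos).1 (EReal.coe_lt_coe_iff.1 hx)
    obtain ⟨τ, hτ, l, hl, hlx⟩ := exists_mem_lambdaSet_lt hρball (hfull ρ hρball) hx'
    refine (iInf₂_le τ hτ).trans ?_
    rw [Dmax_eq_logb_lambdaOf hτ.1 (hfull τ hτ), EReal.coe_le_coe_iff]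
    have hmem := lambdaOf_mem_lambdaSet hτ.1 (hfull τ hτ)
    exact (Real.logb_le_iff_le_rpow one_lt_two (hpos.trans_le (lambdaMin_le hτ hmem))).2
      ((csInf_le bddBelow_lambdaSet hl).trans hlx.le)
  · refine le_iInf₂ fun τ hτ => ?_
    rw [Dmax_eq_logb_lambdaOf hτ.1 (hfull τ hτ), EReal.coe_le_coe_iff]
    exact Real.logb_le_logb_of_le one_lt_two hpos
      (lambdaMin_le hτ (lambdaOf_mem_lambdaSet hτ.1 (hfull τ hτ)))

/-- Above the target value the second program has a positive optimum, and conversely a positive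
optimum exhibits an admissible pair with a smaller first component. -/
lemma muOf_eq_zero_iff (hρ : IsState ρ) (hρball : ρ ∈ smoothBall ε ρ)
    (hfull : ∀ τ ∈ smoothBall ε ρ, (margA ρ ⊗ₖ margB τ).PosDef)
    (hτ : τ ∈ smoothBall ε ρ) (hl : l ∈ lambdaSet ρ τ) :
    muOf ε ρ l = 0 ↔ l = lambdaMin ε ρ := by
  have hg := isGreatest_muSet hρ hfull hτ hl
  constructor
  · intro h0
    refine ((lambdaMin_le hτ hl).eq_or_lt.resolve_right fun hlt => ?_).symm
    obtain ⟨τ', hτ', l', hl', hlt'⟩ := exists_mem_lambdaSet_lt hρball (hfull ρ hρball) hlt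
    obtain ⟨δ, hδ, hle⟩ := exists_pos_smul_one_le (hfull τ' hτ')
    have := hg.2 ⟨τ', muFeasible_of_mem_lambdaSet hτ' hl' hlt'.le hδ.le hle⟩
    rw [h0] at this
    exact this.not_gt (mul_pos (sub_pos.2 hlt') hδ)
  · intro h0
    obtain ⟨τ', h⟩ := hg.1
    have := lambdaMin_le h.2.1 (h.sub_mem_lambdaSet hρ (hfull τ' h.2.1).posSemidef)
    linarith [h.1]

/-! ### Runs of the algorithm -/

lemma exists_isRun (hρ : IsState ρ) (hρball : ρ ∈ smoothBall ε ρ)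
    (hfull : ∀ τ ∈ smoothBall ε ρ, (margA ρ ⊗ₖ margB τ).PosDef) :
    ∃ s : ℕ → Matrix (A × B) (A × B) ℂ, IsRun ε ρ s := by
  have hnext : ∀ τ : smoothBall ε ρ, ∃ τ' : smoothBall ε ρ,
      MuFeasible ε ρ (lambdaOf ρ τ) (muOf ε ρ (lambdaOf ρ τ)) τ' := fun τ => by
    obtain ⟨τ', h⟩ := (isGreatest_muSet hρ hfull τ.2
      (lambdaOf_mem_lambdaSet τ.2.1 (hfull τ τ.2))).1
    exact ⟨⟨τ', h.2.1⟩, h⟩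
  choose next hfeas using hnext
  refine ⟨fun i => (next^[i] ⟨ρ, hρball⟩ : smoothBall ε ρ), rfl, fun i _ => ?_⟩
  simp only [Function.iterate_succ_apply', lam, mu]
  exact hfeas _

lemma IsRun.mem_smoothBall {s : ℕ → Matrix (A × B) (A × B) ℂ} (hs : IsRun ε ρ s)
    (hρball : ρ ∈ smoothBall ε ρ) {i : ℕ} (hi : Reached ε ρ s i) : s i ∈ smoothBall ε ρ := by
  cases i with
  | zero => rwa [hs.1]
  | succ i => exact (hs.2 i hi).2.1

/-- A run that never stops converges: `λ` drops by at least `μ` in each iteration, so `μ → 0`,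
whereas a limit above the target value would keep `μ` bounded away from `0`. -/
lemma IsRun.tendsto_lam {s : ℕ → Matrix (A × B) (A × B) ℂ} (hs : IsRun ε ρ s) (hρ : IsState ρ)
    (hρball : ρ ∈ smoothBall ε ρ)
    (hfull : ∀ τ ∈ smoothBall ε ρ, (margA ρ ⊗ₖ margB τ).PosDef)
    (hne : ∀ i, mu ε ρ s i ≠ 0) :
    Filter.Tendsto (lam ρ s) Filter.atTop (nhds (lambdaMin ε ρ)) := by
  have hball : ∀ i, s i ∈ smoothBall ε ρ := fun i =>
    hs.mem_smoothBall hρball fun j _ => hne j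
  have hmem : ∀ i, lam ρ s i ∈ lambdaSet ρ (s i) := fun i =>
    lambdaOf_mem_lambdaSet (hball i).1 (hfull _ (hball i))
  have hfeas : ∀ i, MuFeasible ε ρ (lam ρ s i) (mu ε ρ s i) (s (i + 1)) := fun i =>
    hs.2 i fun j _ => hne j
  have hstep : ∀ i, lam ρ s (i + 1) ≤ lam ρ s i - mu ε ρ s i := fun i =>
    csInf_le bddBelow_lambdaSet
      ((hfeas i).sub_mem_lambdaSet hρ (hfull _ (hball (i + 1))).posSemidef)
  have hanti : Antitone (lam ρ s) := antitone_nat_of_succ_le fun i => by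
    linarith [hstep i, (hfeas i).1]
  have hlower : ∀ i, lambdaMin ε ρ ≤ lam ρ s i := fun i => lambdaMin_le (hball i) (hmem i)
  have hbdd : BddBelow (Set.range (lam ρ s)) := ⟨_, Set.forall_mem_range.2 hlower⟩
  set L := ⨅ i, lam ρ s i with hL
  have hlim : Filter.Tendsto (lam ρ s) Filter.atTop (nhds L) :=
    tendsto_atTop_ciInf hanti hbdd
  have hmu : Filter.Tendsto (mu ε ρ s) Filter.atTop (nhds 0) := by
    have hdiff := hlim.sub (hlim.comp (Filter.tendsto_add_atTop_nat 1))
    rw [sub_self] at hdiff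
    refine squeeze_zero (fun i => (hfeas i).1) (fun i => ?_) hdiff
    simp only [Function.comp_apply]
    linarith [hstep i]
  have hLeq : lambdaMin ε ρ = L := by
    refine (le_ciInf hlower).eq_or_lt.resolve_right fun hlt => ?_
    obtain ⟨τ, hτ, l, hl, hlL⟩ := exists_mem_lambdaSet_lt hρball (hfull ρ hρball) hlt
    obtain ⟨δ, hδ, hle⟩ := exists_pos_smul_one_le (hfull τ hτ)
    have hbound : ∀ i, (L - l) * δ ≤ mu ε ρ s i := fun i => by
      have hLi : L ≤ lam ρ s i := ciInf_le hbdd i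
      calc (L - l) * δ ≤ (lam ρ s i - l) * δ := by gcongr
        _ ≤ mu ε ρ s i := (isGreatest_muSet hρ hfull (hball i) (hmem i)).2
          ⟨τ, muFeasible_of_mem_lambdaSet hτ hl (hlL.le.trans hLi) hδ.le hle⟩
    exact (ge_of_tendsto' hmu hbound).not_gt (mul_pos (sub_pos.2 hlL) hδ)
  rwa [hLeq]

end Bipartite

end SmoothMaxMutual

end

theorem proposition2 {A B : Type*} [Fintype A] [DecidableEq A] [Fintype B] [DecidableEq B]
    (ρ : Matrix (A × B) (A × B) ℂ) (hρ : SmoothMaxMutual.IsState ρ)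
    (ε : ℝ) (hε : 0 ≤ ε)
    (hfull : ∀ τ ∈ SmoothMaxMutual.smoothBall ε ρ,
      (SmoothMaxMutual.margA ρ ⊗ₖ SmoothMaxMutual.margB τ).PosDef) :
    -- the target value of the algorithm is `2 ^ Imax`
    (0 < SmoothMaxMutual.lambdaMin ε ρ ∧
      SmoothMaxMutual.Imax ε ρ =
        ((Real.logb 2 (SmoothMaxMutual.lambdaMin ε ρ) : ℝ) : EReal)) ∧
    -- the algorithm can be run
    (∃ s : ℕ → Matrix (A × B) (A × B) ℂ, SmoothMaxMutual.IsRun ε ρ s) ∧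
    -- and, whichever maximizers are chosen:
    ∀ s : ℕ → Matrix (A × B) (A × B) ℂ, SmoothMaxMutual.IsRun ε ρ s →
      -- in every iteration carried out both programs attain their optimal values, and the
      -- stopping criterion is met exactly when the current value is the target value
      (∀ i, SmoothMaxMutual.Reached ε ρ s i →
        IsLeast (SmoothMaxMutual.lambdaSet ρ (s i)) (SmoothMaxMutual.lam ρ s i) ∧
        IsGreatest (SmoothMaxMutual.muSet ε ρ (SmoothMaxMutual.lam ρ s i))
          (SmoothMaxMutual.mu ε ρ s i) ∧
        (SmoothMaxMutual.mu ε ρ s i = 0 ↔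
          SmoothMaxMutual.lam ρ s i = SmoothMaxMutual.lambdaMin ε ρ)) ∧
      -- and either the algorithm stops, with the target value, or it converges to it
      ((∃ i, SmoothMaxMutual.Reached ε ρ s i ∧ SmoothMaxMutual.mu ε ρ s i = 0 ∧
          SmoothMaxMutual.lam ρ s i = SmoothMaxMutual.lambdaMin ε ρ) ∨
        ((∀ i, SmoothMaxMutual.mu ε ρ s i ≠ 0) ∧
          Filter.Tendsto (SmoothMaxMutual.lam ρ s) Filter.atTop
            (nhds (SmoothMaxMutual.lambdaMin ε ρ)))) := by
  have hρball := SmoothMaxMutual.mem_smoothBall_self hε hρ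
  refine ⟨⟨zero_lt_one.trans_le
      (SmoothMaxMutual.one_le_lambdaMin hρ hρball (hfull ρ hρball)),
    SmoothMaxMutual.Imax_eq_logb_lambdaMin hρ hρball hfull⟩,
    SmoothMaxMutual.exists_isRun hρ hρball hfull, fun s hs => ?_⟩
  have hiter : ∀ i, SmoothMaxMutual.Reached ε ρ s i →
      IsLeast (SmoothMaxMutual.lambdaSet ρ (s i)) (SmoothMaxMutual.lam ρ s i) ∧
      IsGreatest (SmoothMaxMutual.muSet ε ρ (SmoothMaxMutual.lam ρ s i))
        (SmoothMaxMutual.mu ε ρ s i) ∧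
      (SmoothMaxMutual.mu ε ρ s i = 0 ↔
        SmoothMaxMutual.lam ρ s i = SmoothMaxMutual.lambdaMin ε ρ) := fun i hi => by
    have hb := hs.mem_smoothBall hρball hi
    have hmem := SmoothMaxMutual.lambdaOf_mem_lambdaSet hb.1 (hfull _ hb)
    exact ⟨⟨hmem, fun l hl => csInf_le SmoothMaxMutual.bddBelow_lambdaSet hl⟩,
      SmoothMaxMutual.isGreatest_muSet hρ hfull hb hmem,
      SmoothMaxMutual.muOf_eq_zero_iff hρ hρball hfull hb hmem⟩
  refine ⟨hiter, ?_⟩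
  by_cases hzero : ∃ i, SmoothMaxMutual.mu ε ρ s i = 0
  · -- The first zero of `μ` is the iteration in which the algorithm stops.
    classical
    have hreach : SmoothMaxMutual.Reached ε ρ s (Nat.find hzero) :=
      fun j hj => Nat.find_min hzero hj
    exact Or.inl ⟨_, hreach, Nat.find_spec hzero, (hiter _ hreach).2.2.1 (Nat.find_spec hzero)⟩
  · rw [not_exists] at hzero
    exact Or.inr ⟨hzero, hs.tendsto_lam hρ hρball hfull hzero⟩
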